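/- A monomorphism $i$ in a category is called extremal if for every factorization $i=f\pi$ with $\pi$ an epimorphism, $\pi$ is an isomorphism. Let $\mathcal C$ be a braided monoidal category with braiding $c$ and unit object $\mathbb 1$ such that: 1. $\mathcal C$ has all small limits; 2. $\mathcal C$ has all finite and countable colimits; 3. $\mathcal C$ is (Epi, ExtrMono)-structured: every morphism $f$ can be written $f=i\pi$ with $\pi$ an epimorphism and $i$ an extremal monomorphism, and every commutative square $g\pi=if$ with $\pi$ an epimorphism and $i$ an extremal monomorphism has a diagonal fill-in $t$ (that is, $t\pi=f$ and $it=g$); 4. $\mathcal C$ is cowellpowered: for every object $M$ the equivalence classes of epimorphisms from $M$ form a small set; 5. for every epimorphism $f$ and every object $M$, both $f\otimes\mathrm{id}_M$ and $\mathrm{id}_M\otimes f$ are epimorphisms; 6. the forgetful functor $\mathsf{Mon}(\mathcal C)\to\mathcal C$ from monoids in $\mathcal C$ has a left adjoint. Then the forgetful functor $\mathsf{Hopf}(\mathcal C)\to\mathsf{Bimon}(\mathcal C)$ from Hopf monoids to bimonoids in $\mathcal C$ is full and faithful and has a left adjoint $H_l$; thus Hopf monoids form a reflective subcategory of bimonoids.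 Moreover, $H_l$ can be chosen so that for every bimonoid $B$ the following holds. For $n\ge 0$ let $B^{\mathrm{op}^{-n},\mathrm{cop}^n}$ be the bimonoid on the same object with multiplication $\mu_B\, c_{B,B}^{-n}$ and comultiplication $c_{B,B}^{\,n}\,\Delta_B$, and with the unit and counit of $B$. There is a bimonoid $\tilde B$ with bimonoid homomorphisms $i_n\colon B^{\mathrm{op}^{-n},\mathrm{cop}^n}\to\tilde B$, $n\ge 0$, which is the coproduct of the $B^{\mathrm{op}^{-n},\mathrm{cop}^n}$ both in $\mathsf{Mon}(\mathcal C)$ and in $\mathsf{Bimon}(\mathcal C)$; there is a bimonoid homomorphism $S\colon\tilde B\to\tilde B^{\mathrm{op},\mathrm{cop}^{-1}}$ with $S i_n=i_{n+1}$ for all $n$ (as morphisms of $\mathcal C$); and there is a bimonoid homomorphism $\theta\colon\tilde B\to H_lB$ such that $\theta i_0$ is the unit of the adjunction at $B$ and $\theta$ is the coequalizer, among monoid homomorphisms from $\tilde B$, of the morphisms $S*\mathrm{id}_{\tilde B}$, $\mathrm{id}_{\tilde B}*S$ and $\eta_{\tilde B}\varepsilon_{\tilde B}$ of $\mathcal C$.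 That is, $\theta$ takes the same value on all three, and every monoid homomorphism $\tilde B\to M$ with this property factors through $\theta$ by a unique monoid homomorphism $H_lB\to M$. Here $\varphi*\psi=\mu_{\tilde B}(\varphi\otimes\psi)\Delta_{\tilde B}$ is the convolution product, $\eta_{\tilde B}\colon\mathbb 1\to\tilde B$ is the unit and $\varepsilon_{\tilde B}\colon\tilde B\to\mathbb 1$ the counit of $\tilde B$. -/

import Mathlib

open CategoryTheory MonoidalCategory CategoryTheory.Limits
open scoped MonObj ComonObj

universe w v u

noncomputable section

namespace BimonHopf

section Conditions

variable {C : Type u} [Category.{v} C]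

/-- A monomorphism `i` is extremal if in every factorization of `i` through an epimorphism `π`
(as `π` followed by some morphism), `π` is an isomorphism. -/
structure IsExtremalMono {A B : C} (i : A ⟶ B) : Prop where
  mono : Mono i
  isIso_of_epi_fac : ∀ ⦃Z : C⦄ (π : A ⟶ Z) (f : Z ⟶ B), Epi π → π ≫ f = i → IsIso π

variable (C)

/-- `C` is (Epi, ExtrMono)-structured: every morphism is an epimorphism followed by an extremal
monomorphism, and there are diagonal fill-ins in every commutative square with an epimorphism on
one side and an extremal monomorphism on the opposite side. -/
structure EpiExtrMonoStructured : Prop where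
  exists_fac : ∀ ⦃A B : C⦄ (f : A ⟶ B), ∃ (Z : C) (π : A ⟶ Z) (i : Z ⟶ B),
    Epi π ∧ IsExtremalMono i ∧ π ≫ i = f
  fill_in : ∀ ⦃P Q A B : C⦄ (π : P ⟶ Q) (i : A ⟶ B), Epi π → IsExtremalMono i →
    ∀ (f : P ⟶ A) (g : Q ⟶ B), f ≫ i = π ≫ g → ∃ t : Q ⟶ A, π ≫ t = f ∧ t ≫ i = g

/-- `C` is cowellpowered relative to the universe `w`: for every object `M` the equivalence classes
of epimorphisms from `M`, that is, of monomorphisms to `M` in the opposite category, form a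
`w`-small set. -/
def CoWellPowered : Prop :=
  ∀ M : C, Small.{w} (Subobject (Opposite.op M))

end Conditions

variable {C : Type u} [Category.{v} C] [MonoidalCategory C] [BraidedCategory C]

variable (C) in
/-- The forgetful functor from Hopf monoids to bimonoids. -/
def hopfToBimon : Hopf C ⥤ Bimon C where
  obj H := H.toBimon
  map f := f.hom

theorem braid_aux (X : C) :
    (α_ X X X).hom ≫ (β_ X (X ⊗ X)).hom ≫ (β_ X X).hom ▷ X =
      (β_ (X ⊗ X) X).hom ≫ X ◁ (β_ X X).hom ≫ (α_ X X X).inv := by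
  have h := BraidedCategory.yang_baxter X X X
  simp only [BraidedCategory.braiding_tensor_left_hom, BraidedCategory.braiding_tensor_right_hom,
    Category.assoc, Iso.hom_inv_id_assoc]
  rw [← cancel_epi (α_ X X X).inv, ← cancel_mono (α_ X X X).hom]
  simpa using h

theorem braid_aux_inv (X : C) :
    (β_ X X).inv ▷ X ≫ (β_ X (X ⊗ X)).inv ≫ (α_ X X X).inv =
      (α_ X X X).hom ≫ X ◁ (β_ X X).inv ≫ (β_ (X ⊗ X) X).inv := by
  have h := braid_aux X
  have h2 : (α_ X X X ≪≫ β_ X (X ⊗ X) ≪≫ whiskerRightIso (β_ X X) X).inv =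
    (β_ (X ⊗ X) X ≪≫ whiskerLeftIso X (β_ X X) ≪≫ (α_ X X X).symm).inv := by
    congr 1; ext; simpa using h
  simpa using h2

/-- The monoid `A^{op⁻¹}`: the multiplication of `A` precomposed with the inverse braiding. -/
@[reducible] def opInvMon (X : C) [MonObj X] : MonObj X where
  one := η[X]
  mul := (β_ X X).inv ≫ μ[X]
  one_mul := by
    rw [BraidedCategory.braiding_inv_naturality_left_assoc]
    simp
  mul_one := by
    rw [BraidedCategory.braiding_inv_naturality_right_assoc]
    simp
  mul_assoc := by
    have h := braid_aux_inv X
    simp only [comp_whiskerRight, whiskerLeft_comp, Category.assoc]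
    rw [BraidedCategory.braiding_inv_naturality_left_assoc,
      BraidedCategory.braiding_inv_naturality_right_assoc, MonObj.mul_assoc_flip,
      reassoc_of% h]

/-- The comonoid `A^{cop}`: the comultiplication of `A` followed by the braiding. -/
@[reducible] def copComon (X : C) [ComonObj X] : ComonObj X where
  counit := ε[X]
  comul := Δ[X] ≫ (β_ X X).hom
  counit_comul := by
    rw [Category.assoc, ← BraidedCategory.braiding_naturality_right]
    simp
  comul_counit := by
    rw [Category.assoc, ← BraidedCategory.braiding_naturality_left]
    simp
  comul_assoc := by
    have h := braid_aux X
    simp only [comp_whiskerRight, whiskerLeft_comp, Category.assoc]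
    rw [← BraidedCategory.braiding_naturality_right_assoc,
      ← BraidedCategory.braiding_naturality_left_assoc, ComonObj.comul_assoc_assoc,
      reassoc_of% h]
    simp

theorem tensorμ_yang_baxter_left (X : C) :
    tensorμ X X X X ≫ (β_ X X).hom ▷ (X ⊗ X) ≫ tensorμ X X X X =
      (β_ X X).hom ▷ (X ⊗ X) ≫ tensorμ X X X X ≫ (β_ X X).hom ▷ (X ⊗ X) := by
  have h := BraidedCategory.yang_baxter' X X X
  calc
    _ = 𝟙 _ ⊗≫ (𝟙 ((X ⊗ X) ⊗ X) ⊗≫ (X ◁ (β_ X X).hom ⊗≫ (β_ X X).hom ▷ X ⊗≫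
          X ◁ (β_ X X).hom) ⊗≫ 𝟙 ((X ⊗ X) ⊗ X)) ▷ X ⊗≫ 𝟙 _ := by
      simp only [tensorμ]; monoidal
    _ = _ := by rw [← h]; simp only [tensorμ]; monoidal

theorem tensorμ_yang_baxter_right (X : C) :
    tensorμ X X X X ≫ (X ⊗ X) ◁ (β_ X X).hom ≫ tensorμ X X X X =
      (X ⊗ X) ◁ (β_ X X).hom ≫ tensorμ X X X X ≫ (X ⊗ X) ◁ (β_ X X).hom := by
  have h := BraidedCategory.yang_baxter' X X X
  calc
    _ = 𝟙 _ ⊗≫ X ◁ ((β_ X X).hom ▷ X ⊗≫ X ◁ (β_ X X).hom ⊗≫ (β_ X X).hom ▷ X) ⊗≫ 𝟙 _ := by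
      simp only [tensorμ]; monoidal
    _ = _ := by rw [h]; simp only [tensorμ]; monoidal

theorem braiding_tensor_tensor (X : C) :
    (β_ (X ⊗ X) (X ⊗ X)).hom = tensorμ X X X X ≫ (β_ X X).hom ▷ (X ⊗ X) ≫
      (X ⊗ X) ◁ (β_ X X).hom ≫ tensorμ X X X X := by
  simp only [BraidedCategory.braiding_tensor_left_hom,
    BraidedCategory.braiding_tensor_right_hom, tensorμ]
  monoidal

theorem braid_aux4 (X : C) :
    tensorμ X X X X ≫ (β_ (X ⊗ X) (X ⊗ X)).hom ≫ ((β_ X X).hom ⊗ₘ (β_ X X).hom) =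
    (β_ (X ⊗ X) (X ⊗ X)).hom ≫ ((β_ X X).hom ⊗ₘ (β_ X X).hom) ≫ tensorμ X X X X := by
  have h1 := tensorμ_yang_baxter_left X
  have h3 := tensorμ_yang_baxter_right X
  have h13 := whisker_exchange (β_ X X).hom (β_ X X).hom
  rw [braiding_tensor_tensor, MonoidalCategory.tensorHom_def]
  generalize tensorμ X X X X = s2 at *
  generalize (β_ X X).hom ▷ (X ⊗ X) = s1 at *
  generalize (X ⊗ X) ◁ (β_ X X).hom = s3 at *
  simp only [Category.assoc]
  rw [← h13, ← reassoc_of% h3, reassoc_of% h1, ← reassoc_of% h13, ← h1,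
    reassoc_of% h3, reassoc_of% h13]


theorem opInvCop_mul_comul (X : C) [BimonObj X] :
    ((β_ X X).inv ≫ μ[X]) ≫ Δ[X] ≫ (β_ X X).hom =
      ((Δ[X] ≫ (β_ X X).hom) ⊗ₘ (Δ[X] ≫ (β_ X X).hom)) ≫ tensorμ X X X X ≫
        (((β_ X X).inv ≫ μ[X]) ⊗ₘ ((β_ X X).inv ≫ μ[X])) := by
  have h := braid_aux4 X
  have h' : (β_ (X ⊗ X) (X ⊗ X)).inv ≫ tensorμ X X X X ≫ (β_ (X ⊗ X) (X ⊗ X)).hom =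
      ((β_ X X).hom ⊗ₘ (β_ X X).hom) ≫ tensorμ X X X X ≫
        ((β_ X X).inv ⊗ₘ (β_ X X).inv) := by
    rw [Iso.inv_comp_eq, ← cancel_mono ((β_ X X).hom ⊗ₘ (β_ X X).hom)]
    simpa only [Category.assoc, tensorHom_comp_tensorHom, Iso.inv_hom_id, id_tensorHom_id,
      Category.comp_id] using h
  simp only [← tensorHom_comp_tensorHom, Category.assoc]
  rw [← reassoc_of% h', BimonObj.mul_comul_assoc]
  rw [BraidedCategory.braiding_naturality, ← BraidedCategory.braiding_inv_naturality_assoc]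

theorem opInvCop_one_comul (X : C) [BimonObj X] :
    η[X] ≫ Δ[X] ≫ (β_ X X).hom = (λ_ (𝟙_ C)).inv ≫ (η[X] ⊗ₘ η[X]) := by
  rw [Bimon.one_comul_assoc, BraidedCategory.braiding_naturality]
  simp [unitors_inv_equal]

theorem opInvCop_mul_counit (X : C) [BimonObj X] :
    ((β_ X X).inv ≫ μ[X]) ≫ ε[X] = (ε[X] ⊗ₘ ε[X]) ≫ (λ_ (𝟙_ C)).hom := by
  rw [Category.assoc, Bimon.mul_counit, ← BraidedCategory.braiding_inv_naturality_assoc]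
  simp [unitors_equal]

/-- The bimonoid structure `B^{op⁻¹,cop}` on the object underlying a bimonoid `B`. -/
@[reducible] def opInvCop (X : C) [BimonObj X] : BimonObj X where
  __ := opInvMon X
  __ := copComon X
  mul_comul := opInvCop_mul_comul X
  one_comul := opInvCop_one_comul X
  mul_counit := opInvCop_mul_counit X
  one_counit := BimonObj.one_counit X

/-- A bimonoid morphism from a morphism of `C` that respects all four structure morphisms. -/
def bimonHomMk {M N : Bimon C} (f : M.X.X ⟶ N.X.X) (h1 : η[M.X.X] ≫ f = η[N.X.X])
    (h2 : μ[M.X.X] ≫ f = (f ⊗ₘ f) ≫ μ[N.X.X])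
    (h3 : f ≫ ε[N.X.X] = ε[M.X.X]) (h4 : f ≫ Δ[N.X.X] = Δ[M.X.X] ≫ (f ⊗ₘ f)) : M ⟶ N :=
  Comon.Hom.mk' (Mon.Hom.mk' f h1 h2) (Mon.Hom.ext h3) (Mon.Hom.ext h4)

/-- The endofunctor `B ↦ B^{op⁻¹,cop}` of the category of bimonoids, the identity on underlying
objects and morphisms. -/
def opInvCopFunctor : Bimon C ⥤ Bimon C where
  obj B := @Bimon.mk' C _ _ _ B.X.X (opInvCop B.X.X)
  map {M N} f := bimonHomMk f.hom.hom
    (IsMonHom.one_hom f.hom.hom)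
    (by
      change ((β_ _ _).inv ≫ μ[M.X.X]) ≫ f.hom.hom =
        (f.hom.hom ⊗ₘ f.hom.hom) ≫ (β_ _ _).inv ≫ μ[N.X.X]
      rw [Category.assoc, IsMonHom.mul_hom, BraidedCategory.braiding_inv_naturality_assoc])
    (congrArg Mon.Hom.hom f.isComonHom_hom.hom_counit)
    (by
      have h : f.hom.hom ≫ Δ[N.X.X] = Δ[M.X.X] ≫ (f.hom.hom ⊗ₘ f.hom.hom) :=
        congrArg Mon.Hom.hom f.isComonHom_hom.hom_comul
      change f.hom.hom ≫ Δ[N.X.X] ≫ (β_ _ _).hom =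
        (Δ[M.X.X] ≫ (β_ _ _).hom) ≫ (f.hom.hom ⊗ₘ f.hom.hom)
      rw [reassoc_of% h, Category.assoc, BraidedCategory.braiding_naturality])

/-- The bimonoid `B^{op⁻ⁿ,copⁿ}`, with multiplication `μ ∘ c⁻ⁿ` and comultiplication `cⁿ ∘ Δ` on the
object underlying `B`. -/
def twist (B : Bimon C) : ℕ → Bimon C
  | 0 => B
  | n + 1 => opInvCopFunctor.obj (twist B n)

/-- The convolution product of two endomorphisms of the object underlying a bimonoid. -/
def conv {X : C} [BimonObj X] (f g : X ⟶ X) : X ⟶ X :=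
  Δ[X] ≫ (f ⊗ₘ g) ≫ μ[X]

/-- The morphism `f` satisfies `f ∘ (S * id) = f ∘ (id * S) = f ∘ η ∘ ε`. -/
def Coequalizes {X Y : C} [BimonObj X] (S : X ⟶ X) (f : X ⟶ Y) : Prop :=
  conv S (𝟙 X) ≫ f = (ε[X] ≫ η[X]) ≫ f ∧ conv (𝟙 X) S ≫ f = (ε[X] ≫ η[X]) ≫ f

/-- The bimonoid morphism `u : B ⟶ P` arises as follows. Let `D`, with the morphisms `i n`, be the
coproduct of the bimonoids `B^{op⁻ⁿ,copⁿ}`, `n = 0, 1, 2, …`, both in monoids and in bimonoids, and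
let `S` be the bimonoid morphism from `D` to `D^{op,cop⁻¹}` (equivalently, with the same underlying
morphism, from `D^{op⁻¹,cop}` to `D`) that carries `i n` to `i (n + 1)`. Then `u` is `i 0` followed
by a bimonoid morphism `θ : D ⟶ P` that is the coequalizer of `S * id`, `id * S` and `η ∘ ε` among
monoid morphisms from `D`. -/
def IsCoequalizerOfCoproduct {B P : Bimon C} (u : B ⟶ P) : Prop :=
  ∃ (D : Bimon C) (i : ∀ n : ℕ, twist B n ⟶ D) (S : opInvCopFunctor.obj D ⟶ D) (θ : D ⟶ P),
    Nonempty (IsColimit (Cofan.mk D.X fun n => (i n).hom)) ∧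
    Nonempty (IsColimit (Cofan.mk D i)) ∧
    (∀ n : ℕ, opInvCopFunctor.map (i n) ≫ S = i (n + 1)) ∧
    Coequalizes (X := D.X.X) S.hom.hom θ.hom.hom ∧
    (∀ (M : Mon C) (f : D.X ⟶ M), Coequalizes (X := D.X.X) S.hom.hom f.hom →
      ∃! g : P.X ⟶ M, θ.hom ≫ g = f) ∧
    i 0 ≫ θ = u

end BimonHopf

end

noncomputable section

/-! The antipode of a Hopf monoid `H` is a bimonoid morphism `H^{op⁻¹,cop} ⟶ H`. So a bimonoid
morphism `f : B ⟶ H`, followed by powers of the antipode, gives one morphism to `H` from each twist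
of `B`, hence a morphism `F` from their coproduct `D` that carries the shift `S` of `D` to the
antipode. Imposing `S * id = η ∘ ε = id * S` on `D` turns `S` into an antipode, and the quotient `P`
is the reflection of `B`.

Quotients of a monoid by relations exist by cowellpoweredness: take the image of the monoid in the
product of a small set of representatives of all quotients satisfying the relations
(`exists_universal_quotient`). Coproducts of monoids are such quotients of free monoids, and they
inherit comonoid structures by their universal property.

The counit, comultiplication and antipode descend to `P` because `ε`, `(θ ⊗ θ) ∘ Δ` and `θ ∘ S`
satisfy the relations that `θ` satisfies (`coequalizes_counit`, `coequalizes_comul`,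
`coequalizes_comp`). As `θ` is epic in `C`, the Hopf axioms can be checked on `D`. Morphisms out of
`P` are determined on `B` because bimonoid morphisms of Hopf monoids commute with antipodes
(`existsUnique_desc`). -/

namespace BimonHopf

/-! ### Comonoid structures along jointly epic families -/

section JointlyEpic

variable {V : Type u} [Category.{v} V] {K : Type*}

/-- A family of morphisms with common target is jointly epic. -/
def JointlyEpic {A : K → V} {D : V} (i : ∀ n, A n ⟶ D) : Prop :=
  ∀ ⦃Z : V⦄ (f g : D ⟶ Z), (∀ n, i n ≫ f = i n ≫ g) → f = g

theorem jointlyEpic_of_isColimit {A : K → V} {D : V} {i : ∀ n, A n ⟶ D}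
    (h : IsColimit (Cofan.mk D i)) : JointlyEpic i :=
  fun _ _ _ w => Cofan.IsColimit.hom_ext h _ _ w

variable [MonoidalCategory V]

/-- The target of a jointly epic family of morphisms from comonoids is a comonoid as soon as
the counits and comultiplications extend to it. -/
@[reducible] def comonObjOfJointlyEpic {A : K → V} [∀ n, ComonObj (A n)] {D : V}
    {i : ∀ n, A n ⟶ D} (hi : JointlyEpic i) (e : D ⟶ 𝟙_ V) (d : D ⟶ D ⊗ D)
    (he : ∀ n, i n ≫ e = ε[A n]) (hd : ∀ n, i n ≫ d = Δ[A n] ≫ (i n ⊗ₘ i n)) : ComonObj D where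
  counit := e
  comul := d
  counit_comul := hi _ _ fun n => by
    rw [reassoc_of% hd n, ← tensorHom_id, tensorHom_comp_tensorHom, he, Category.comp_id,
      ComonObj.counit_comul_hom]
  comul_counit := hi _ _ fun n => by
    rw [reassoc_of% hd n, ← id_tensorHom, tensorHom_comp_tensorHom, he, Category.comp_id,
      ComonObj.comul_counit_hom]
  comul_assoc := hi _ _ fun n => by
    rw [reassoc_of% hd n, reassoc_of% hd n, ← id_tensorHom, ← tensorHom_id,
      tensorHom_comp_tensorHom, tensorHom_comp_tensorHom_assoc, hd, Category.comp_id,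
      ← whiskerLeft_comp_tensorHom, ComonObj.comul_assoc_assoc, ← associator_naturality,
      whiskerRight_comp_tensorHom_assoc]

theorem isComonHom_of_jointlyEpic {A : K → V} [∀ n, ComonObj (A n)] {D M : V} [ComonObj D]
    [ComonObj M] {i : ∀ n, A n ⟶ D} (hi : JointlyEpic i) [∀ n, IsComonHom (i n)] (f : D ⟶ M)
    [∀ n, IsComonHom (i n ≫ f)] : IsComonHom f where
  hom_counit := hi _ _ fun n => by
    rw [← Category.assoc, IsComonHom.hom_counit, IsComonHom.hom_counit]
  hom_comul := hi _ _ fun n => by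
    rw [← Category.assoc, IsComonHom.hom_comul, IsComonHom.hom_comul_assoc,
      tensorHom_comp_tensorHom]

/-- A cofan of comonoids is a coproduct if the underlying cofan is. -/
def isColimitOfUnderlying {A : K → Comon V} {D : Comon V} (i : ∀ n, A n ⟶ D)
    (h : IsColimit (Cofan.mk D.X fun n => (i n).hom)) : IsColimit (Cofan.mk D i) :=
  have hi := jointlyEpic_of_isColimit h
  Cofan.IsColimit.mk _
    (fun s =>
      have fac (n) : (i n).hom ≫ Cofan.IsColimit.desc h (fun n => (s.inj n).hom) =
          (s.inj n).hom := Cofan.IsColimit.fac h _ n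
      have : ∀ n, IsComonHom ((i n).hom ≫
          Cofan.IsColimit.desc h (fun n => (s.inj n).hom)) := fun n => by
        rw [fac]; infer_instance
      have := isComonHom_of_jointlyEpic hi (Cofan.IsColimit.desc h (fun n => (s.inj n).hom))
      Comon.Hom.mk (Cofan.IsColimit.desc h (fun n => (s.inj n).hom)))
    (fun s n => Comon.Hom.ext (Cofan.IsColimit.fac h _ n))
    (fun s m w => Comon.Hom.ext (hi _ _ fun n =>
      (congrArg Comon.Hom.hom (w n)).trans (Cofan.IsColimit.fac h (fun n => (s.inj n).hom) n).symm))

end JointlyEpic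

/-! ### Images, universal quotients and coproducts of monoids -/

section Quotients

variable {C : Type u} [Category.{v} C] [MonoidalCategory C]

/-- A subobject closed under unit and multiplication is a monoid. -/
@[reducible] def monObjOfMono {Z M : C} [MonObj M] (i : Z ⟶ M) [Mono i] (e : 𝟙_ C ⟶ Z)
    (m : Z ⊗ Z ⟶ Z) (he : e ≫ i = η[M]) (hm : m ≫ i = (i ⊗ₘ i) ≫ μ[M]) : MonObj Z where
  one := e
  mul := m
  one_mul := by
    rw [← cancel_mono i, Category.assoc, hm, ← tensorHom_id, tensorHom_comp_tensorHom_assoc, he,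
      Category.id_comp, MonObj.one_mul_hom]
  mul_one := by
    rw [← cancel_mono i, Category.assoc, hm, ← id_tensorHom, tensorHom_comp_tensorHom_assoc, he,
      Category.id_comp, MonObj.mul_one_hom]
  mul_assoc := by
    rw [← cancel_mono i]
    simp only [Category.assoc, hm]
    rw [← id_tensorHom, ← tensorHom_id, tensorHom_comp_tensorHom_assoc,
      tensorHom_comp_tensorHom_assoc, hm, Category.id_comp,
      ← Category.comp_id i, ← tensorHom_comp_tensorHom_assoc, Category.comp_id i,
      tensorHom_id, MonObj.mul_assoc, associator_naturality_assoc, ← id_tensorHom,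
      tensorHom_comp_tensorHom_assoc, Category.comp_id]

/-- Tensoring with any object preserves epimorphisms. -/
def TensorPreservesEpi (C : Type u) [Category.{v} C] [MonoidalCategory C] : Prop :=
  ∀ ⦃X Y : C⦄ (f : X ⟶ Y), Epi f → ∀ M : C, Epi (f ▷ M) ∧ Epi (M ◁ f)

theorem TensorPreservesEpi.tensorHom (h : TensorPreservesEpi C) {X Y X' Y' : C} (f : X ⟶ Y)
    (g : X' ⟶ Y') [Epi f] [Epi g] : Epi (f ⊗ₘ g) := by
  have := (h f inferInstance X').1
  have := (h g inferInstance Y).2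
  rw [MonoidalCategory.tensorHom_def]
  infer_instance

/-- The factorization of a monoid morphism as a morphism that is epic in the underlying category
followed by one that is monic there. -/
theorem exists_mon_image (h_epi : TensorPreservesEpi C) (h_struct : EpiExtrMonoStructured C)
    {A M : Mon C} (f : A ⟶ M) :
    ∃ (Z : Mon C) (π : A ⟶ Z) (i : Z ⟶ M), Epi π.hom ∧ Mono i.hom ∧ π ≫ i = f := by
  obtain ⟨Z, π, i, hπ, hi, fac⟩ := h_struct.exists_fac f.hom
  have := hi.mono
  -- The multiplication of the image is the diagonal of the square with the epimorphism `π ⊗ π`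
  -- opposite `i`.
  obtain ⟨m, hm1, hm2⟩ := h_struct.fill_in (π ⊗ₘ π) i (h_epi.tensorHom π π) hi (μ[A.X] ≫ π) ((i ⊗ₘ i) ≫ μ[M.X])
    (by rw [Category.assoc, fac, tensorHom_comp_tensorHom_assoc, fac, IsMonHom.mul_hom])
  have he : (η[A.X] ≫ π) ≫ i = η[M.X] := by rw [Category.assoc, fac, IsMonHom.one_hom]
  let := monObjOfMono i (η[A.X] ≫ π) m he hm2
  exact ⟨⟨Z⟩, Mon.Hom.mk' π rfl hm1.symm, Mon.Hom.mk' i he hm2, hπ, hi.mono, Mon.Hom.ext fac⟩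

/-- Descending a monoid morphism along a monoid morphism that is epic in the underlying
category. -/
theorem exists_mon_desc (h_epi : TensorPreservesEpi C) {A Q M : Mon C} (q : A ⟶ Q)
    [Epi q.hom] (f : A ⟶ M) (g : Q.X ⟶ M.X) (hg : q.hom ≫ g = f.hom) :
    ∃ g' : Q ⟶ M, q ≫ g' = f := by
  have := h_epi.tensorHom q.hom q.hom
  refine ⟨Mon.Hom.mk' g ?_ ?_, Mon.Hom.ext hg⟩
  · rw [← IsMonHom.one_hom q.hom, Category.assoc, hg, IsMonHom.one_hom]
  · rw [← cancel_epi (q.hom ⊗ₘ q.hom), ← IsMonHom.mul_hom_assoc, hg, IsMonHom.mul_hom,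
      tensorHom_comp_tensorHom_assoc, hg]

/-- In a cowellpowered category, up to isomorphism there is only a small set of monoid morphisms
from a given monoid that have a given property and are epic in the underlying category. -/
theorem exists_small_quotients (h_epi : TensorPreservesEpi C) (h_cwp : CoWellPowered.{w} C)
    (A : Mon C) (p : ∀ ⦃Q : Mon C⦄, (A ⟶ Q) → Prop) :
    ∃ (J : Type w) (Z : J → Mon C) (π : ∀ j, A ⟶ Z j), (∀ j, p (π j)) ∧
      ∀ ⦃Q : Mon C⦄ (q : A ⟶ Q), Epi q.hom → p q → ∃ j g, π j ≫ g = q := by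
  have := h_cwp A.X
  let T := {s : Subobject (Opposite.op A.X) //
    ∃ (Q : Mon C) (q : A ⟶ Q) (_ : Epi q.hom), p q ∧ Subobject.mk q.hom.op = s}
  choose Q q hq hp hs using fun s : T => s.2
  let e := equivShrink.{w} T
  refine ⟨Shrink.{w} T, fun j => Q (e.symm j), fun j => q _, fun j => hp _, ?_⟩
  intro Q' q' hq' hp'
  let s : T := ⟨_, Q', q', hq', hp', rfl⟩
  refine ⟨e s, ?_⟩
  change ∃ g : Q (e.symm (e s)) ⟶ Q', q (e.symm (e s)) ≫ g = q'
  -- `Q` and `q` depend on this index, so it is made a variable before being identified with `s`.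
  generalize hs' : e.symm (e s) = s'
  obtain rfl : s = s' := by simpa using hs'
  have h := hs s
  have := hq s
  let iso := Subobject.isoOfMkEqMk _ _ h
  refine exists_mon_desc h_epi (q s) q' iso.inv.unop ?_
  apply Quiver.Hom.op_inj
  simp [iso]

/-- Given a class `R` of parallel pairs into a monoid `A`, there is a universal monoid morphism
from `A` that coequalizes all of them, and it is epic in the underlying category. -/
theorem exists_universal_quotient (h_lim : HasLimitsOfSize.{w, w} C)
    (h_struct : EpiExtrMonoStructured C) (h_cwp : CoWellPowered.{w} C)
    (h_epi : TensorPreservesEpi C) (A : Mon C)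
    (R : ∀ ⦃X : C⦄, (X ⟶ A.X) → (X ⟶ A.X) → Prop) :
    ∃ (Q : Mon C) (θ : A ⟶ Q), Epi θ.hom ∧
      (∀ ⦃X : C⦄ (r s : X ⟶ A.X), R r s → r ≫ θ.hom = s ≫ θ.hom) ∧
      ∀ (M : Mon C) (f : A ⟶ M),
        (∀ ⦃X : C⦄ (r s : X ⟶ A.X), R r s → r ≫ f.hom = s ≫ f.hom) →
          ∃! g : Q ⟶ M, θ ≫ g = f := by
  obtain ⟨J, Z, π, hπ, hJ⟩ := exists_small_quotients h_epi h_cwp A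
    (fun Q q => ∀ ⦃X : C⦄ (r s : X ⟶ A.X), R r s → r ≫ q.hom = s ≫ q.hom)
  -- The universal quotient is the image of `A` in the product of the representatives.
  obtain ⟨Q, θ, i, hθ, hi, fac⟩ := exists_mon_image h_epi h_struct (Pi.lift π)
  have hpi (j : J) : θ ≫ i ≫ Pi.π Z j = π j := by
    rw [← Category.assoc, fac, Pi.lift_π]
  refine ⟨Q, θ, hθ, fun X r s h => ?_, fun M f hf => ?_⟩
  · rw [← cancel_mono i.hom]
    -- `r` and `s` are only morphisms of `C`; since the forgetful functor preserves the product,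
    -- they can be compared componentwise there.
    refine (isLimitOfPreserves (Mon.forget C) (limit.isLimit (Discrete.functor Z))).hom_ext ?_
    rintro ⟨j⟩
    have h1 := congrArg Mon.Hom.hom (hpi j)
    have h2 := hπ j r s h
    rw [← h1] at h2
    simp only [Mon.comp_hom', ← Category.assoc] at h2
    exact h2
  -- The image part of `f` satisfies the relations because `i'` is monic, so it factors through a
  -- representative.
  · obtain ⟨Q', q', i', hq', hi', fac'⟩ := exists_mon_image h_epi h_struct f
    obtain ⟨j, g, hg⟩ := hJ q' hq' fun X r s h => by
      rw [← cancel_mono i'.hom]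
      have h2 := hf r s h
      rw [← fac'] at h2
      simpa using h2
    refine ⟨(i ≫ Pi.π Z j) ≫ g ≫ i', ?_, fun y hy => ?_⟩
    · change θ ≫ (i ≫ Pi.π Z j) ≫ g ≫ i' = f
      rw [← Category.assoc, hpi, reassoc_of% hg, fac']
    · apply Mon.Hom.ext
      rw [← cancel_epi θ.hom, ← Mon.comp_hom', ← Mon.comp_hom', hy]
      rw [← Category.assoc, hpi, reassoc_of% hg, fac']

/-- The relations that make a family of morphisms into the monoid `F` multiplicative. -/
inductive MultiplicativityRel {K : Type*} (A : K → Mon C) {F : C} [MonObj F]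
    (j : ∀ n, (A n).X ⟶ F) : ∀ ⦃X : C⦄, (X ⟶ F) → (X ⟶ F) → Prop
  | one (n : K) : MultiplicativityRel A j (η[(A n).X] ≫ j n) η[F]
  | mul (n : K) : MultiplicativityRel A j (μ[(A n).X] ≫ j n) ((j n ⊗ₘ j n) ≫ μ[F])

theorem exists_free_mon (h_free : (Mon.forget C).IsRightAdjoint) (X : C) :
    ∃ (F : Mon C) (u : X ⟶ F.X), ∀ (M : Mon C) (f : X ⟶ M.X), ∃! g : F ⟶ M, u ≫ g.hom = f := by
  let adj := Adjunction.ofIsRightAdjoint (Mon.forget C)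
  have h (M : Mon C) (g : (Mon.forget C).leftAdjoint.obj X ⟶ M) :
      adj.homEquiv X M g = adj.unit.app X ≫ g.hom := adj.homEquiv_unit X M g
  refine ⟨(Mon.forget C).leftAdjoint.obj X, adj.unit.app X, fun M f =>
    ⟨(adj.homEquiv X M).symm f, (h _ _).symm.trans (Equiv.apply_symm_apply _ _), fun g hg => ?_⟩⟩
  exact (Equiv.eq_symm_apply _).2 ((h _ _).trans hg)

/-- Coproducts of monoids, as universal quotients of free monoids. -/
theorem exists_mon_coproduct (h_lim : HasLimitsOfSize.{w, w} C)
    (h_struct : EpiExtrMonoStructured C) (h_cwp : CoWellPowered.{w} C)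
    (h_epi : TensorPreservesEpi C) (h_free : (Mon.forget C).IsRightAdjoint) {K : Type*}
    (A : K → Mon C) [HasCoproduct fun n => (A n).X] :
    ∃ (D : Mon C) (i : ∀ n, A n ⟶ D), Nonempty (IsColimit (Cofan.mk D i)) := by
  obtain ⟨F, u, hF⟩ := exists_free_mon h_free (∐ fun n => (A n).X)
  let j (n : K) : (A n).X ⟶ F.X := Sigma.ι (fun n => (A n).X) n ≫ u
  obtain ⟨D, θ, -, hθ, hD⟩ := exists_universal_quotient h_lim h_struct h_cwp h_epi F
    (MultiplicativityRel A j)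
  let i (n : K) : A n ⟶ D := Mon.Hom.mk' (j n ≫ θ.hom)
    (by rw [← Category.assoc, hθ _ _ (.one n), IsMonHom.one_hom])
    (by rw [← Category.assoc, hθ _ _ (.mul n), Category.assoc, IsMonHom.mul_hom,
      tensorHom_comp_tensorHom_assoc])
  have key (s : Cofan A) : ∃! g : D ⟶ s.pt, ∀ n, i n ≫ g = s.inj n := by
    obtain ⟨f, hf, hf'⟩ := hF s.pt (Sigma.desc fun n => (s.inj n).hom)
    have hj (n) : j n ≫ f.hom = (s.inj n).hom := by
      simp only [j, Category.assoc, hf, Sigma.ι_desc]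
    obtain ⟨g, hg, huniq⟩ := hD s.pt f (by
      rintro _ _ _ (n | n)
      · rw [Category.assoc, hj, IsMonHom.one_hom, IsMonHom.one_hom]
      · rw [Category.assoc, hj, IsMonHom.mul_hom, Category.assoc, IsMonHom.mul_hom,
          tensorHom_comp_tensorHom_assoc, hj])
    refine ⟨g, fun n => Mon.Hom.ext ?_, fun g' hg' => huniq _ (hf' _ ?_)⟩
    · change (j n ≫ θ.hom) ≫ g.hom = _
      rw [Category.assoc, ← Mon.comp_hom', hg, hj]
    · refine Sigma.hom_ext _ _ fun n => ?_
      rw [Sigma.ι_desc, ← hg' n]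
      simp [i, j]
  choose g hg huniq using key
  exact ⟨D, i, ⟨Cofan.IsColimit.mk _ g hg fun s m hm => huniq s m hm⟩⟩

end Quotients

/-! ### Convolution -/

section Convolution

variable {C : Type u} [Category.{v} C] [MonoidalCategory C]

/-- The convolution product of two morphisms from a comonoid to a monoid. -/
def convMul {X M : C} [ComonObj X] [MonObj M] (f g : X ⟶ M) : X ⟶ M :=
  Δ[X] ≫ (f ⊗ₘ g) ≫ μ[M]

theorem convMul_eq {X M : C} [ComonObj X] [MonObj M] (f g : X ⟶ M) :
    convMul f g = ((show Conv X M from f) * (show Conv X M from g) : Conv X M) := by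
  rw [convMul, MonoidalCategory.tensorHom_def, Category.assoc]
  rfl

theorem convMul_comp {X M N : C} [ComonObj X] [MonObj M] [MonObj N] (f g : X ⟶ M) (h : M ⟶ N)
    [IsMonHom h] : convMul f g ≫ h = convMul (f ≫ h) (g ≫ h) := by
  simp only [convMul, Category.assoc, IsMonHom.mul_hom, tensorHom_comp_tensorHom_assoc]

/-- By associativity of convolution, `(a * c) * (d * b) = a * (c * d) * b`, which telescopes. -/
theorem convMul_mul_mul {X M : C} [ComonObj X] [MonObj M] {a b c d : X ⟶ M}
    (h1 : convMul a b = ε[X] ≫ η[M]) (h2 : convMul c d = ε[X] ≫ η[M]) :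
    convMul (convMul a c) (convMul d b) = ε[X] ≫ η[M] := by
  rw [convMul_eq (convMul a c), convMul_eq a c, convMul_eq d b]
  rw [convMul_eq] at h1 h2
  rw [← Conv.one_eq] at h1 h2 ⊢
  generalize (show Conv X M from a) = a at *
  generalize (show Conv X M from b) = b at *
  generalize (show Conv X M from c) = c at *
  generalize (show Conv X M from d) = d at *
  change (a * c) * (d * b) = 1
  rw [mul_assoc, ← mul_assoc c, h2, one_mul, h1]

end Convolution

/-! ### Twisted endomorphisms and opposite monoids -/

section Braided

variable {C : Type u} [Category.{v} C] [MonoidalCategory C] [BraidedCategory C]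

/-- The inclusion of the left factor of a tensor product of monoids. -/
def monInl (P Q : Mon C) : P ⟶ P ⊗ Q :=
  (ρ_ P).inv ≫ P ◁ (show 𝟙_ (Mon C) ⟶ Q from (default : Mon.trivial C ⟶ Q))

/-- The inclusion of the right factor of a tensor product of monoids. -/
def monInr (P Q : Mon C) : Q ⟶ P ⊗ Q :=
  (λ_ Q).inv ≫ (show 𝟙_ (Mon C) ⟶ P from (default : Mon.trivial C ⟶ P)) ▷ Q

theorem monInl_hom (P Q : Mon C) : (monInl P Q).hom = (ρ_ P.X).inv ≫ (𝟙 P.X ⊗ₘ η[Q.X]) := by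
  rw [id_tensorHom]; rfl

theorem monInr_hom (P Q : Mon C) : (monInr P Q).hom = (λ_ Q.X).inv ≫ (η[P.X] ⊗ₘ 𝟙 Q.X) := by
  rw [tensorHom_id]; rfl

theorem monInl_monInr_mul (P Q : Mon C) :
    ((monInl P Q).hom ⊗ₘ (monInr P Q).hom) ≫ μ[P.X ⊗ Q.X] = 𝟙 _ := by
  rw [monInl_hom, monInr_hom, ← tensorHom_comp_tensorHom, Category.assoc,
    MonObj.tensorObj.mul_def, tensorμ_natural_assoc, tensorHom_comp_tensorHom]
  simp only [MonObj.mul_one_hom, MonObj.one_mul_hom, Category.comp_id]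
  simp only [tensorμ, braiding_tensorUnit_left]
  monoidal

/-- The two factors commute only up to the braiding; this is what absorbs the braiding in
`IsTwistedEndo.hom_comul`. -/
theorem monInr_monInl_mul (P Q : Mon C) :
    ((monInr P Q).hom ⊗ₘ (monInl P Q).hom) ≫ μ[P.X ⊗ Q.X] = (β_ Q.X P.X).hom := by
  rw [monInl_hom, monInr_hom, ← tensorHom_comp_tensorHom, Category.assoc,
    MonObj.tensorObj.mul_def, tensorμ_natural_assoc, tensorHom_comp_tensorHom]
  simp only [MonObj.mul_one_hom, MonObj.one_mul_hom, Category.comp_id]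
  simp only [tensorμ]
  monoidal

/-- An endomorphism of the object underlying a bimonoid `X` that is a bimonoid morphism from
`X^{op⁻¹,cop}` to `X`. -/
structure IsTwistedEndo {X : C} [BimonObj X] (s : X ⟶ X) : Prop where
  one_hom : η[X] ≫ s = η[X]
  mul_hom : μ[X] ≫ s = (s ⊗ₘ s) ≫ (β_ X X).hom ≫ μ[X]
  hom_counit : s ≫ ε[X] = ε[X]
  hom_comul : s ≫ Δ[X] = Δ[X] ≫ (β_ X X).hom ≫ (s ⊗ₘ s)

namespace IsTwistedEndo

variable {X : C} [BimonObj X] {s : X ⟶ X}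

/-- The braidings from reversing the product and the coproduct match by naturality, and the two
convolution factors change places. -/
theorem conv_left_comp (hs : IsTwistedEndo s) : conv s (𝟙 X) ≫ s = s ≫ conv (𝟙 X) s := by
  simp only [conv, Category.assoc, hs.mul_hom, reassoc_of% hs.hom_comul,
    tensorHom_comp_tensorHom_assoc, Category.id_comp, Category.comp_id,
    BraidedCategory.braiding_naturality_assoc]

theorem conv_right_comp (hs : IsTwistedEndo s) : conv (𝟙 X) s ≫ s = s ≫ conv s (𝟙 X) := by
  simp only [conv, Category.assoc, hs.mul_hom, reassoc_of% hs.hom_comul,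
    tensorHom_comp_tensorHom_assoc, Category.id_comp, Category.comp_id,
    BraidedCategory.braiding_naturality_assoc]

/-- Composition with `s` interchanges the two conditions. This makes the antipode descend. -/
theorem coequalizes_comp (hs : IsTwistedEndo s) {Y : C} {f : X ⟶ Y} (h : Coequalizes s f) :
    Coequalizes s (s ≫ f) := by
  have e : (ε[X] ≫ η[X]) ≫ s ≫ f = s ≫ (ε[X] ≫ η[X]) ≫ f := by
    simp only [Category.assoc, reassoc_of% hs.one_hom, reassoc_of% hs.hom_counit]
  constructor
  · rw [e, ← h.2, ← Category.assoc, hs.conv_left_comp, Category.assoc]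
  · rw [e, ← h.1, ← Category.assoc, hs.conv_right_comp, Category.assoc]

theorem coequalizes_counit (hs : IsTwistedEndo s) : Coequalizes s ε[X] := by
  have h : (ε[X] ≫ η[X]) ≫ ε[X] = ε[X] := by simp
  constructor <;> rw [h, conv, Category.assoc, Category.assoc, Bimon.mul_counit,
    tensorHom_comp_tensorHom_assoc, hs.hom_counit] <;> simp [← unitors_inv_equal]

end IsTwistedEndo

/-- For monoid morphisms the condition says that `s ≫ f` is a two-sided convolution inverse of `f`.
-/
theorem coequalizes_iff {X M : C} [BimonObj X] [MonObj M] (s : X ⟶ X) (f : X ⟶ M) [IsMonHom f] :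
    Coequalizes s f ↔ convMul (s ≫ f) f = ε[X] ≫ η[M] ∧ convMul f (s ≫ f) = ε[X] ≫ η[M] := by
  have h1 : conv s (𝟙 X) ≫ f = convMul (s ≫ f) f :=
    (convMul_comp s (𝟙 X) f).trans (by rw [Category.id_comp])
  have h2 : conv (𝟙 X) s ≫ f = convMul f (s ≫ f) :=
    (convMul_comp (𝟙 X) s f).trans (by rw [Category.id_comp])
  rw [Coequalizes, h1, h2, Category.assoc, IsMonHom.one_hom]

/-- In convolution notation, `Δ ≫ (f ⊗ₘ f)` is `inl f * inr f`. Precomposed with `s`, which reverses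
`Δ`, it becomes `inr (s ≫ f) * inl (s ≫ f)`. These are mutually inverse, since each factor cancels
its partner. -/
theorem IsTwistedEndo.coequalizes_comul {X : C} [BimonObj X] {s : X ⟶ X} (hs : IsTwistedEndo s)
    {P : Mon C} (f : X ⟶ P.X) [IsMonHom f] (h : Coequalizes s f)
    [IsMonHom (Δ[X] ≫ (f ⊗ₘ f))] :
    Coequalizes s (Δ[X] ≫ (f ⊗ₘ f)) := by
  rw [coequalizes_iff] at h ⊢
  have hl : IsMonHom (monInl P P).hom := (monInl P P).isMonHom_hom
  have hr : IsMonHom (monInr P P).hom := (monInr P P).isMonHom_hom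
  have e1 : Δ[X] ≫ (f ⊗ₘ f) = convMul (f ≫ (monInl P P).hom) (f ≫ (monInr P P).hom) := by
    rw [convMul, ← tensorHom_comp_tensorHom_assoc]
    erw [monInl_monInr_mul]
    rw [Category.comp_id]
  have e2 : s ≫ Δ[X] ≫ (f ⊗ₘ f) =
      convMul ((s ≫ f) ≫ (monInr P P).hom) ((s ≫ f) ≫ (monInl P P).hom) := by
    rw [convMul, ← tensorHom_comp_tensorHom_assoc]
    erw [monInr_monInl_mul]
    rw [reassoc_of% hs.hom_comul, tensorHom_comp_tensorHom,
      BraidedCategory.braiding_naturality]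
  have inl1 : convMul ((s ≫ f) ≫ (monInl P P).hom) (f ≫ (monInl P P).hom) =
      ε[X] ≫ η[P.X ⊗ P.X] := by
    rw [← IsMonHom.one_hom (monInl P P).hom, ← Category.assoc ε[X], ← h.1]
    exact (convMul_comp _ _ _).symm
  have inl2 : convMul (f ≫ (monInl P P).hom) ((s ≫ f) ≫ (monInl P P).hom) =
      ε[X] ≫ η[P.X ⊗ P.X] := by
    rw [← IsMonHom.one_hom (monInl P P).hom, ← Category.assoc ε[X], ← h.2]
    exact (convMul_comp _ _ _).symm
  have inr1 : convMul ((s ≫ f) ≫ (monInr P P).hom) (f ≫ (monInr P P).hom) =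
      ε[X] ≫ η[P.X ⊗ P.X] := by
    rw [← IsMonHom.one_hom (monInr P P).hom, ← Category.assoc ε[X], ← h.1]
    exact (convMul_comp _ _ _).symm
  have inr2 : convMul (f ≫ (monInr P P).hom) ((s ≫ f) ≫ (monInr P P).hom) =
      ε[X] ≫ η[P.X ⊗ P.X] := by
    rw [← IsMonHom.one_hom (monInr P P).hom, ← Category.assoc ε[X], ← h.2]
    exact (convMul_comp _ _ _).symm
  rw [e2, e1]
  exact ⟨convMul_mul_mul inr1 inl1, convMul_mul_mul inl2 inr2⟩

theorem braid_aux_op (X : C) :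
    (β_ X X).hom ▷ X ≫ (β_ (X ⊗ X) X).hom ≫ (α_ X X X).inv =
      (α_ X X X).hom ≫ X ◁ (β_ X X).hom ≫ (β_ X (X ⊗ X)).hom := by
  have h := BraidedCategory.yang_baxter X X X
  simp only [BraidedCategory.braiding_tensor_left_hom, BraidedCategory.braiding_tensor_right_hom]
  rw [← cancel_epi (α_ X X X).inv, ← cancel_mono (α_ X X X).hom]
  simpa using h

/-- The monoid `A^{op}`: the multiplication of `A` precomposed with the braiding. -/
@[reducible] def opMonObj (X : C) [MonObj X] : MonObj X where
  one := η[X]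
  mul := (β_ X X).hom ≫ μ[X]
  one_mul := by
    rw [BraidedCategory.braiding_naturality_left_assoc]
    simp
  mul_one := by
    rw [BraidedCategory.braiding_naturality_right_assoc]
    simp
  mul_assoc := by
    have h := braid_aux_op X
    simp only [comp_whiskerRight, whiskerLeft_comp, Category.assoc]
    rw [BraidedCategory.braiding_naturality_left_assoc,
      BraidedCategory.braiding_naturality_right_assoc, MonObj.mul_assoc_flip,
      reassoc_of% h]

/-- The monoid `A^{op}`. -/
def opMon (M : Mon C) : Mon C := @Mon.mk C _ _ M.X (opMonObj M.X)

/-- The endofunctor `A ↦ A^{op⁻¹}` of the category of monoids. -/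
def opInvFunctor : Mon C ⥤ Mon C where
  obj M := @Mon.mk C _ _ M.X (opInvMon M.X)
  map {M N} f := @Mon.Hom.mk' _ _ _ (@Mon.mk C _ _ M.X (opInvMon M.X))
    (@Mon.mk C _ _ N.X (opInvMon N.X)) f.hom (IsMonHom.one_hom f.hom) (by
      change ((β_ _ _).inv ≫ μ[M.X]) ≫ f.hom = (f.hom ⊗ₘ f.hom) ≫ (β_ _ _).inv ≫ μ[N.X]
      rw [Category.assoc, IsMonHom.mul_hom, BraidedCategory.braiding_inv_naturality_assoc])

/-- Naturality moves the inverse braiding on the source to a braiding on the target. Hence `op⁻¹` is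
left adjoint to `op` and preserves coproducts. -/
theorem opInv_mul_comp_iff {X Y : C} [MonObj X] [MonObj Y] (f : X ⟶ Y) :
    ((β_ X X).inv ≫ μ[X]) ≫ f = (f ⊗ₘ f) ≫ μ[Y] ↔
      μ[X] ≫ f = (f ⊗ₘ f) ≫ (β_ Y Y).hom ≫ μ[Y] := by
  rw [Category.assoc, Iso.inv_comp_eq, BraidedCategory.braiding_naturality_assoc]

/-- Monoid morphisms from `M^{op⁻¹}` to `N` are monoid morphisms from `M` to `N^{op}`. -/
def opHomEquiv (M N : Mon C) : (opInvFunctor.obj M ⟶ N) ≃ (M ⟶ opMon N) where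
  toFun f := @Mon.Hom.mk' _ _ _ M (opMon N) f.hom (IsMonHom.one_hom f.hom)
    ((opInv_mul_comp_iff (X := M.X) (Y := N.X) f.hom).1 (IsMonHom.mul_hom f.hom))
  invFun f := @Mon.Hom.mk' _ _ _ (opInvFunctor.obj M) N f.hom (IsMonHom.one_hom f.hom)
    ((opInv_mul_comp_iff (X := M.X) (Y := N.X) f.hom).2 (IsMonHom.mul_hom f.hom))
  left_inv _ := rfl
  right_inv _ := rfl

theorem opHomEquiv_naturality {L M N : Mon C} (i : L ⟶ M) (f : opInvFunctor.obj M ⟶ N) :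
    opHomEquiv L N (opInvFunctor.map i ≫ f) = i ≫ opHomEquiv M N f := rfl

/-- The functor `A ↦ A^{op⁻¹}` preserves coproducts. -/
def isColimitOpInv {K : Type*} {A : K → Mon C} {D : Mon C} {i : ∀ n, A n ⟶ D}
    (h : IsColimit (Cofan.mk D i)) :
    IsColimit (Cofan.mk (opInvFunctor.obj D) fun n => opInvFunctor.map (i n)) :=
  Cofan.IsColimit.mk _
    (fun s => (opHomEquiv D s.pt).symm
      (Cofan.IsColimit.desc h fun n => opHomEquiv (A n) s.pt (s.inj n)))
    (fun s n => (opHomEquiv (A n) s.pt).injective <| by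
      refine (opHomEquiv_naturality (i n) _).trans ?_
      rw [Equiv.apply_symm_apply]
      exact Cofan.IsColimit.fac h _ n)
    (fun s m w => (Equiv.eq_symm_apply _).2 (Cofan.IsColimit.hom_ext h _ _ fun n => by
      refine (opHomEquiv_naturality (i n) m).symm.trans ?_
      refine (congrArg _ (w n)).trans ?_
      exact (Cofan.IsColimit.fac h (fun n => opHomEquiv (A n) s.pt (s.inj n)) n).symm))

end Braided

/-! ### Coproducts of bimonoids -/

theorem exists_comon_coproduct {V : Type u} [Category.{v} V] [MonoidalCategory V] {K : Type*}
    (A : K → Comon V) {D : V} {i : ∀ n, (A n).X ⟶ D} (h : IsColimit (Cofan.mk D i)) :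
    ∃ (E : Comon V) (j : ∀ n, A n ⟶ E),
      Nonempty (IsColimit (Cofan.mk E.X fun n => (j n).hom)) := by
  let e : D ⟶ 𝟙_ V := Cofan.IsColimit.desc h fun n => ε[(A n).X]
  let d : D ⟶ D ⊗ D := Cofan.IsColimit.desc h fun n => Δ[(A n).X] ≫ (i n ⊗ₘ i n)
  have he (n) : i n ≫ e = ε[(A n).X] := Cofan.IsColimit.fac h _ n
  have hd (n) : i n ≫ d = Δ[(A n).X] ≫ (i n ⊗ₘ i n) :=
    Cofan.IsColimit.fac h (fun n => Δ[(A n).X] ≫ (i n ⊗ₘ i n)) n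
  let := comonObjOfJointlyEpic (jointlyEpic_of_isColimit h) e d he hd
  exact ⟨⟨D⟩, fun n => Comon.Hom.mk' (i n) (he n) (hd n), ⟨h⟩⟩

/-- A single epimorphism is a family over `Unit`, so the results on jointly epic families serve
quotients as well as coproducts. -/
theorem jointlyEpic_of_epi_hom {C : Type u} [Category.{v} C] [MonoidalCategory C] {A Q : Mon C}
    (θ : A ⟶ Q) (h : Epi θ.hom) : JointlyEpic fun _ : Unit => θ := fun _ _ _ w =>
  Mon.Hom.ext ((cancel_epi θ.hom).1 (congrArg Mon.Hom.hom (w ())))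

variable {C : Type u} [Category.{v} C] [MonoidalCategory C] [BraidedCategory C]

instance instComonObjX (D : Bimon C) : ComonObj D.X := Comon.comon D

theorem bimonHom_counit {M N : Bimon C} (f : M ⟶ N) : f.hom.hom ≫ ε[N.X.X] = ε[M.X.X] :=
  congrArg Mon.Hom.hom f.isComonHom_hom.hom_counit

theorem bimonHom_comul {M N : Bimon C} (f : M ⟶ N) :
    f.hom.hom ≫ Δ[N.X.X] = Δ[M.X.X] ≫ (f.hom.hom ⊗ₘ f.hom.hom) :=
  congrArg Mon.Hom.hom f.isComonHom_hom.hom_comul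

instance {M N : Bimon C} (f : M ⟶ N) : IsBimonHom f.hom.hom where
  one_hom := f.hom.isMonHom_hom.one_hom
  mul_hom := f.hom.isMonHom_hom.mul_hom
  hom_counit := bimonHom_counit f
  hom_comul := bimonHom_comul f

theorem isTwistedEndo_of_hom {D : Bimon C} (S : opInvCopFunctor.obj D ⟶ D) :
    IsTwistedEndo (X := D.X.X) S.hom.hom where
  one_hom := S.hom.isMonHom_hom.one_hom
  mul_hom := (opInv_mul_comp_iff (X := D.X.X) (Y := D.X.X) S.hom.hom).1
    S.hom.isMonHom_hom.mul_hom
  hom_counit := bimonHom_counit S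
  hom_comul := (bimonHom_comul S).trans (Category.assoc _ _ _)

/-- The functor `B ↦ B^{op⁻¹,cop}` preserves those coproducts of bimonoids that are coproducts of
monoids. -/
def isColimitOpInvCop {K : Type*} {A : K → Bimon C} {D : Bimon C} (i : ∀ n, A n ⟶ D)
    (h : IsColimit (Cofan.mk D.X fun n => (i n).hom)) :
    IsColimit (Cofan.mk (opInvCopFunctor.obj D) fun n => opInvCopFunctor.map (i n)) :=
  isColimitOfUnderlying (V := Mon C) (fun n => opInvCopFunctor.map (i n)) (isColimitOpInv h)

/-! ### The Hopf quotient -/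

/-- The pairs of morphisms that a quotient has to identify for `s` to become an antipode. -/
inductive AntipodeRel {X : C} [BimonObj X] (s : X ⟶ X) : ∀ ⦃Z : C⦄, (Z ⟶ X) → (Z ⟶ X) → Prop
  | left : AntipodeRel s (conv s (𝟙 X)) (ε[X] ≫ η[X])
  | right : AntipodeRel s (conv (𝟙 X) s) (ε[X] ≫ η[X])

theorem forall_antipodeRel_iff {X Y : C} [BimonObj X] (s : X ⟶ X) (f : X ⟶ Y) :
    (∀ ⦃Z : C⦄ (r t : Z ⟶ X), AntipodeRel s r t → r ≫ f = t ≫ f) ↔ Coequalizes s f := by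
  refine ⟨fun h => ⟨h _ _ .left, h _ _ .right⟩, ?_⟩
  rintro h _ _ _ (_ | _)
  exacts [h.1, h.2]

theorem conv_comp_bimonHom {X Y : C} [BimonObj X] [BimonObj Y] (f : X ⟶ Y) [IsBimonHom f]
    {s s' : X ⟶ X} {t t' : Y ⟶ Y} (h : s ≫ f = f ≫ t) (h' : s' ≫ f = f ≫ t') :
    conv s s' ≫ f = f ≫ conv t t' := by
  simp only [conv, Category.assoc, IsMonHom.mul_hom, IsComonHom.hom_comul_assoc,
    tensorHom_comp_tensorHom_assoc, h, h']

theorem counit_one_comp_bimonHom {X Y : C} [BimonObj X] [BimonObj Y] (f : X ⟶ Y)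
    [IsBimonHom f] : (ε[X] ≫ η[X]) ≫ f = f ≫ ε[Y] ≫ η[Y] := by
  rw [Category.assoc, IsMonHom.one_hom, IsComonHom.hom_counit_assoc]

/-- Used in both directions: to obtain the antipode axioms on a quotient, and to show that a
morphism to a Hopf monoid satisfies the relations. -/
theorem coequalizes_bimonHom_iff {X Y : C} [BimonObj X] [BimonObj Y] {s : X ⟶ X} {t : Y ⟶ Y}
    (f : X ⟶ Y) [IsBimonHom f] (h : s ≫ f = f ≫ t) :
    Coequalizes s f ↔ f ≫ conv t (𝟙 Y) = f ≫ ε[Y] ≫ η[Y] ∧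
      f ≫ conv (𝟙 Y) t = f ≫ ε[Y] ≫ η[Y] := by
  have h1 : 𝟙 X ≫ f = f ≫ 𝟙 Y := by rw [Category.id_comp, Category.comp_id]
  rw [Coequalizes, conv_comp_bimonHom f h h1, conv_comp_bimonHom f h1 h,
    counit_one_comp_bimonHom]

/-- The Hopf monoid structure on a quotient bimonoid to which the morphism `s` descends as an
antipode. -/
def hopfOfEpi {D P : Bimon C} (θ : D ⟶ P) [Epi θ.hom.hom] {s : D.X.X ⟶ D.X.X}
    (hs : Coequalizes s θ.hom.hom) (a : P.X.X ⟶ P.X.X)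
    (ha : θ.hom.hom ≫ a = s ≫ θ.hom.hom) : Hopf C where
  X := P.X.X
  hopf :=
    have h := (coequalizes_bimonHom_iff θ.hom.hom ha.symm).1 hs
    { antipode := a
      antipode_left := by
        rw [← tensorHom_id]; exact (cancel_epi θ.hom.hom).1 h.1
      antipode_right := by
        rw [← id_tensorHom]; exact (cancel_epi θ.hom.hom).1 h.2 }

/-- The antipode of a Hopf monoid `H` as a bimonoid morphism from `H^{op⁻¹,cop}` to `H`. -/
def antipodeHom (H : Hopf C) : opInvCopFunctor.obj H.toBimon ⟶ H.toBimon :=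
  bimonHomMk (M := opInvCopFunctor.obj H.toBimon) (N := H.toBimon)
    (HopfObj.antipode (X := H.X)) (HopfObj.one_antipode H.X)
    ((opInv_mul_comp_iff (X := H.X) (Y := H.X) _).2 (HopfObj.mul_antipode H.X))
    (HopfObj.antipode_counit H.X)
    ((HopfObj.antipode_comul H.X).trans (Category.assoc _ _ _).symm)

/-- The universal quotient of a bimonoid `D` on which a bimonoid morphism from `D^{op⁻¹,cop}` to
`D` becomes an antipode. -/
theorem exists_hopf_quotient (h_lim : HasLimitsOfSize.{w, w} C)
    (h_struct : EpiExtrMonoStructured C) (h_cwp : CoWellPowered.{w} C)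
    (h_epi : TensorPreservesEpi C) (D : Bimon C) (S : opInvCopFunctor.obj D ⟶ D) :
    ∃ (P : Hopf C) (θ : D ⟶ P.toBimon), Epi θ.hom.hom ∧
      Coequalizes (X := D.X.X) S.hom.hom θ.hom.hom ∧
      S ≫ θ = opInvCopFunctor.map θ ≫ antipodeHom P ∧
      ∀ (M : Mon C) (f : D.X ⟶ M), Coequalizes (X := D.X.X) S.hom.hom f.hom →
        ∃! g : P.toBimon.X ⟶ M, θ.hom ≫ g = f := by
  obtain ⟨Q, θ, hθ, hθS, hQ⟩ := exists_universal_quotient h_lim h_struct h_cwp h_epi D.X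
    (AntipodeRel (X := D.X.X) S.hom.hom)
  replace hθS := (forall_antipodeRel_iff (X := D.X.X) _ _).1 hθS
  replace hQ (M : Mon C) (f : D.X ⟶ M) (hf : Coequalizes (X := D.X.X) S.hom.hom f.hom) :=
    hQ M f ((forall_antipodeRel_iff (X := D.X.X) _ _).2 hf)
  have hS := isTwistedEndo_of_hom S
  have hepi := jointlyEpic_of_epi_hom θ hθ
  obtain ⟨e, he, -⟩ := hQ (𝟙_ (Mon C)) ε[D.X] hS.coequalizes_counit
  obtain ⟨d, hd, -⟩ := hQ (Q ⊗ Q) (Δ[D.X] ≫ (θ ⊗ₘ θ))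
    (@IsTwistedEndo.coequalizes_comul _ _ _ _ D.X.X _ _ hS Q θ.hom _ hθS
      (Δ[D.X] ≫ (θ ⊗ₘ θ)).isMonHom_hom)
  -- An antipode reverses products, so it is sought as a monoid morphism from `Q` to `Q^{op}`.
  obtain ⟨a, ha, -⟩ := hQ (opMon Q) (opHomEquiv D.X Q (S.hom ≫ θ)) (hS.coequalizes_comp hθS)
  let cQ : ComonObj Q := comonObjOfJointlyEpic (A := fun _ : Unit => D.X) hepi e d
    (fun _ => he) (fun _ => hd)
  let P : Bimon C := (⟨Q⟩ : Comon (Mon C))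
  let θ' : D ⟶ P := Comon.Hom.mk' θ he hd
  have ha' : θ.hom ≫ a.hom = S.hom.hom ≫ θ.hom := congrArg Mon.Hom.hom ha
  have : Epi θ'.hom.hom := hθ
  exact ⟨hopfOfEpi θ' hθS a.hom ha', θ', hθ, hθS, Bimon.ext ha'.symm, hQ⟩

theorem antipodeHom_comp {G H : Hopf C} (f : G.toBimon ⟶ H.toBimon) :
    antipodeHom G ≫ f = opInvCopFunctor.map f ≫ antipodeHom H :=
  Bimon.ext (@HopfObj.hom_antipode C _ _ _ G.X H.X _ _ f.hom.hom
    (inferInstanceAs (IsBimonHom f.hom.hom))).symm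

theorem conv_antipode_left (H : Hopf C) :
    conv (HopfObj.antipode (X := H.X)) (𝟙 H.X) = ε[H.X] ≫ η[H.X] := by
  rw [conv, tensorHom_id, HopfObj.antipode_left]

theorem conv_antipode_right (H : Hopf C) :
    conv (𝟙 H.X) (HopfObj.antipode (X := H.X)) = ε[H.X] ≫ η[H.X] := by
  rw [conv, id_tensorHom, HopfObj.antipode_right]

/-! ### The universal property -/

/-- The iterates of the antipode of `H`, starting from a bimonoid morphism `f` to `H`. -/
def twistHom {B : Bimon C} (H : Hopf C) (f : B ⟶ H.toBimon) : ∀ n, twist B n ⟶ H.toBimon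
  | 0 => f
  | n + 1 => opInvCopFunctor.map (twistHom H f n) ≫ antipodeHom H

theorem existsUnique_desc {B D : Bimon C} {i : ∀ n, twist B n ⟶ D}
    (hD : IsColimit (Cofan.mk D i))
    (hD' : IsColimit (Cofan.mk (opInvCopFunctor.obj D) fun n => opInvCopFunctor.map (i n)))
    {S : opInvCopFunctor.obj D ⟶ D} (hS : ∀ n, opInvCopFunctor.map (i n) ≫ S = i (n + 1))
    {P : Hopf C} {θ : D ⟶ P.toBimon} (hθ : Epi θ.hom.hom)
    (hSθ : S ≫ θ = opInvCopFunctor.map θ ≫ antipodeHom P)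
    (hP : ∀ (M : Mon C) (f : D.X ⟶ M), Coequalizes (X := D.X.X) S.hom.hom f.hom →
      ∃! g : P.toBimon.X ⟶ M, θ.hom ≫ g = f)
    (H : Hopf C) (f : B ⟶ H.toBimon) :
    ∃! g : P.toBimon ⟶ H.toBimon, (i 0 ≫ θ) ≫ g = f := by
  have hepi := jointlyEpic_of_epi_hom θ.hom hθ
  let F : D ⟶ H.toBimon := Cofan.IsColimit.desc hD (twistHom H f)
  have hF (n) : i n ≫ F = twistHom H f n := Cofan.IsColimit.fac hD _ n
  have hSF : S ≫ F = opInvCopFunctor.map F ≫ antipodeHom H := by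
    -- On the `n`-th summand both sides are `twistHom H f (n + 1)`.
    refine Cofan.IsColimit.hom_ext hD' _ _ fun n => ?_
    have h : (opInvCopFunctor.map (i n) ≫ S) ≫ F =
        opInvCopFunctor.map (twistHom H f n) ≫ antipodeHom H :=
      (congrArg (· ≫ F) (hS n)).trans (hF (n + 1))
    change opInvCopFunctor.map (i n) ≫ S ≫ F = opInvCopFunctor.map (i n) ≫ _
    rw [← Category.assoc, h, ← Functor.map_comp_assoc, hF]
  have : IsBimonHom (M := D.X.X) (N := H.X) F.hom.hom :=
    inferInstanceAs (IsBimonHom (M := D.X.X) (N := H.toBimon.X.X) F.hom.hom)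
  obtain ⟨g, hg, -⟩ := hP H.toBimon.X F.hom
    ((coequalizes_bimonHom_iff (X := D.X.X) (Y := H.X) F.hom.hom
      (congrArg (fun f : opInvCopFunctor.obj D ⟶ H.toBimon => f.hom.hom) hSF)).2
      ⟨congrArg (F.hom.hom ≫ ·) (conv_antipode_left H),
        congrArg (F.hom.hom ≫ ·) (conv_antipode_right H)⟩)
  have hgF : IsComonHom (θ.hom ≫ g) := by rw [hg]; exact F.isComonHom_hom
  have : IsComonHom θ.hom := θ.isComonHom_hom
  -- `g` respects the comonoid structures because `θ` is epic and both `θ` and `θ ≫ g = F` respect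
  -- them.
  have hgc : IsComonHom g := isComonHom_of_jointlyEpic hepi g
  let g' : P.toBimon ⟶ H.toBimon := Comon.Hom.mk g
  have hg' : θ ≫ g' = F := Comon.Hom.ext hg
  refine ⟨g', ?_, fun k hk => ?_⟩
  · change (i 0 ≫ θ) ≫ g' = f
    rw [Category.assoc, hg', hF]
    rfl
  · suffices h : θ ≫ k = F from
      Comon.Hom.ext (hepi _ _ fun _ => congrArg Comon.Hom.hom (h.trans hg'.symm))
    refine Cofan.IsColimit.hom_ext hD _ _ fun n => ?_
    change i n ≫ θ ≫ k = i n ≫ F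
    rw [hF]
    -- Since `k` commutes with the antipodes, its value on the summand `n + 1` is determined by its
    -- value on the summand `n`.
    induction n with
    | zero => exact (Category.assoc _ _ _).symm.trans hk
    | succ n ih =>
      refine (congrArg (· ≫ θ ≫ k) (hS n)).symm.trans ?_
      change (opInvCopFunctor.map (i n) ≫ S) ≫ θ ≫ k =
        opInvCopFunctor.map (twistHom H f n) ≫ antipodeHom H
      rw [Category.assoc, reassoc_of% hSθ, antipodeHom_comp, ← Functor.map_comp_assoc,
        ← Functor.map_comp_assoc, Category.assoc, ih]

theorem exists_hopf_reflection (h_lim : HasLimitsOfSize.{w, w} C)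
    (h_colim : HasCountableColimits C) (h_struct : EpiExtrMonoStructured C)
    (h_cwp : CoWellPowered.{w} C) (h_epi : TensorPreservesEpi C)
    (h_free : (Mon.forget C).IsRightAdjoint) (B : Bimon C) :
    ∃ (P : Hopf C) (u : B ⟶ P.toBimon), IsCoequalizerOfCoproduct u ∧
      ∀ (H : Hopf C) (f : B ⟶ H.toBimon), ∃! g : P.toBimon ⟶ H.toBimon, u ≫ g = f := by
  obtain ⟨D₀, i₀, ⟨hD₀⟩⟩ := exists_mon_coproduct h_lim h_struct h_cwp h_epi h_free
    fun n => (twist B n).X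
  obtain ⟨D, i, ⟨hD⟩⟩ : ∃ (D : Bimon C) (i : ∀ n, twist B n ⟶ D),
      Nonempty (IsColimit (Cofan.mk D.X fun n => (i n).hom)) :=
    exists_comon_coproduct (V := Mon C) (twist B) hD₀
  have hDB : IsColimit (Cofan.mk D i) := isColimitOfUnderlying (V := Mon C) i hD
  have hDop := isColimitOpInvCop i hD
  let S : opInvCopFunctor.obj D ⟶ D := Cofan.IsColimit.desc hDop fun n => i (n + 1)
  have hS (n : ℕ) : opInvCopFunctor.map (i n) ≫ S = i (n + 1) :=
    Cofan.IsColimit.fac hDop (fun n => i (n + 1)) n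
  obtain ⟨P, θ, hθ, hθS, hSθ, hP⟩ := exists_hopf_quotient h_lim h_struct h_cwp h_epi D S
  exact ⟨P, i 0 ≫ θ, ⟨D, i, S, θ, ⟨hD⟩, ⟨hDB⟩, hS, hθS, hP, rfl⟩,
    existsUnique_desc hDB hDop hS hθ hSθ hP⟩

end BimonHopf

end

/-! ### The adjunction -/

theorem mainTheorem2 {C : Type u} [Category.{v} C] [MonoidalCategory C] [BraidedCategory C]
    (h_limits : HasLimitsOfSize.{w, w} C)
    (h_colimits : HasCountableColimits C)
    (h_structured : BimonHopf.EpiExtrMonoStructured C)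
    (h_cowellpowered : BimonHopf.CoWellPowered.{w} C)
    (h_epi : ∀ ⦃X Y : C⦄ (f : X ⟶ Y), Epi f → ∀ M : C, Epi (f ▷ M) ∧ Epi (M ◁ f))
    (h_free : (Mon.forget C).IsRightAdjoint) :
    ∃ (Hl : Bimon C ⥤ Hopf C) (adj : Hl ⊣ BimonHopf.hopfToBimon C),
      (BimonHopf.hopfToBimon C).Full ∧ (BimonHopf.hopfToBimon C).Faithful ∧
      ∀ B : Bimon C, BimonHopf.IsCoequalizerOfCoproduct (adj.unit.app B) := by
  choose P u hu hP using BimonHopf.exists_hopf_reflection h_limits h_colimits h_structured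
    h_cowellpowered h_epi h_free
  choose g hg huniq using hP
  let e (B : Bimon C) (H : Hopf C) : (P B ⟶ H) ≃ (B ⟶ (BimonHopf.hopfToBimon C).obj H) :=
    { toFun := fun f => u B ≫ f.hom
      invFun := fun f => ⟨g B H f⟩
      left_inv := fun f => InducedCategory.Hom.ext (huniq B H _ f.hom rfl).symm
      right_inv := fun f => hg B H f }
  let adj := Adjunction.adjunctionOfEquivLeft (G := BimonHopf.hopfToBimon C) e
    fun B H H' k f => (Category.assoc (u B) f.hom k.hom).symm
  refine ⟨_, adj, ⟨fun f => ⟨⟨f⟩, rfl⟩⟩, ⟨fun h => InducedCategory.Hom.ext h⟩, fun B => ?_⟩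
  -- The unit is the image under `e` of the identity of `P B`.
  have h : adj.unit.app B = u B := by
    rw [← adj.homEquiv_id]
    simp only [adj, Adjunction.adjunctionOfEquivLeft, Adjunction.mkOfHomEquiv_homEquiv]
    exact Category.comp_id (u B)
  rw [h]
  exact hu B
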